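/- Let $n\ge 1$, let $A=\{a_1,\dots,a_n\}$ and $B=\{b_1,\dots,b_n\}$ be disjoint sets. A *fractional matching* is a matrix $p=(p_{i,j})_{1\le i,j\le n}$ of nonnegative reals all of whose row sums and column sums equal $1$; $p_{i,j}$ is the weight of the pair $(a_i,b_j)$. A *perfect matching* is (the set of pairs of) a bijection $M:A\to B$. A *metric* is a function $d:(A\cup B)\times(A\cup B)\to\mathbb R_{\ge 0}$ with $d(x,x)=0$, $d(x,y)=d(y,x)$ and $d(x,y)\le d(x,z)+d(z,y)$ (distinct points may have distance $0$). Let $\alpha(n)$ be the smallest real number $\alpha$ such that for every fractional matching $p$ there is a perfect matching $M$ such that, for all metrics $d$ on $A\cup B$, $$\sum_{(a_i,b_j)\in M} d(a_i,b_j)\;\le\;\alpha\sum_{1\le i,j\le n}p_{i,j}\,d(a_i,b_j).$$ Let $\beta(n)$ be the smallest real number $\beta$ such that for every fractional matching $p$ there is a perfect matching $M$ such that, for all $S\subseteq A\cup B$, $$|\{(a_i,b_j)\in M : (a_i,b_j)\text{ crosses }S\}|\;\le\;\beta\sum_{(a_i,b_j)\text{ crosses }S}p_{i,j},$$ where a pair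 $(a_i,b_j)$ crosses $S$ if exactly one of $a_i,b_j$ lies in $S$. Then, for every $n\ge 1$, both of these smallest numbers exist and $\beta(n)\le\alpha(n)$; and there is an absolute constant $C>0$ such that $\alpha(n)\le C\log n\cdot\beta(n)$ for all $n\ge 2$. -/

import Mathlib

noncomputable section

namespace ThinMatching

/-- The vertices: `Sum.inl i` is the `i`-th agent `a_i` (left vertex) and `Sum.inr j` is the `j`-th
item `b_j` (right vertex). -/
abbrev Vertex (n : ℕ) : Type := Fin n ⊕ Fin n

/-- A fractional matching gives weight `p i j ≥ 0` to each pair `(a_i, b_j)`, such that all row sums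
and all column sums are `1`. -/
def IsFractionalMatching {n : ℕ} (p : Matrix (Fin n) (Fin n) ℝ) : Prop :=
  p ∈ doublyStochastic ℝ (Fin n)

/-- Perfect matchings are bijections from the left vertices to the right vertices: `M i = j` means
that `a_i` is matched to `b_j`. -/
abbrev PerfectMatching (n : ℕ) : Type := Fin n ≃ Fin n

/-- The cost of a perfect matching. Distinct points are allowed to have distance `0`. -/
def cost {n : ℕ} (d : PseudoMetric (Vertex n) ℝ) (M : PerfectMatching n) : ℝ :=
  ∑ i, d (Sum.inl i) (Sum.inr (M i))

/-- The cost of a fractional matching. -/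
def fractionalCost {n : ℕ} (d : PseudoMetric (Vertex n) ℝ) (p : Matrix (Fin n) (Fin n) ℝ) : ℝ :=
  ∑ i, ∑ j, p i j * d (Sum.inl i) (Sum.inr j)

/-- The factor `a` is valid for rounding: every fractional matching can be rounded to a single
perfect matching whose cost is at most `a` times larger in all metrics at once. -/
def IsRoundingFactor (n : ℕ) (a : ℝ) : Prop :=
  ∀ p : Matrix (Fin n) (Fin n) ℝ, IsFractionalMatching p →
    ∃ M : PerfectMatching n, ∀ d : PseudoMetric (Vertex n) ℝ, cost d M ≤ a * fractionalCost d p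

/-- The edge `(a_i, b_j)` crosses the cut `(S, Sᶜ)`: exactly one of its ends lies in `S`. -/
abbrev Crosses {n : ℕ} (S : Finset (Vertex n)) (i j : Fin n) : Prop :=
  Xor (Sum.inl i ∈ S) (Sum.inr j ∈ S)

/-- The number of edges of the perfect matching `M` across the cut `(S, Sᶜ)`. -/
def cutSize {n : ℕ} (M : PerfectMatching n) (S : Finset (Vertex n)) : ℕ :=
  (Finset.univ.filter fun i => Crosses S i (M i)).card

/-- The total weight of the fractional matching `p` across the cut `(S, Sᶜ)`. -/
def cutWeight {n : ℕ} (p : Matrix (Fin n) (Fin n) ℝ) (S : Finset (Vertex n)) : ℝ :=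
  ∑ i, ∑ j ∈ Finset.univ.filter fun j => Crosses S i j, p i j

/-- The perfect matching `M` is `b`-thin with respect to the fractional matching `p`. -/
def IsThin {n : ℕ} (b : ℝ) (p : Matrix (Fin n) (Fin n) ℝ) (M : PerfectMatching n) : Prop :=
  ∀ S : Finset (Vertex n), (cutSize M S : ℝ) ≤ b * cutWeight p S

/-- The factor `b` is valid for thin matchings: for every fractional matching there is a `b`-thin
perfect matching. -/
def IsThinnessFactor (n : ℕ) (b : ℝ) : Prop :=
  ∀ p : Matrix (Fin n) (Fin n) ℝ, IsFractionalMatching p → ∃ M : PerfectMatching n, IsThin b p M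

/-- The best rounding factor `α(n)`. -/
def optRounding (n : ℕ) : ℝ := sInf {a : ℝ | IsRoundingFactor n a}

/-- The best thinness factor `β(n)`. -/
def optThinness (n : ℕ) : ℝ := sInf {b : ℝ | IsThinnessFactor n b}

end ThinMatching

end

noncomputable section

namespace ThinMatching

open Finset MeasureTheory

/-! Cuts are particular metrics, so every rounding factor is a thinness factor; hence `β ≤ α`.
Conversely, a thin matching is cheap in every line metric `|f x - f y|`, which is the integral over
`s` of the cuts `{f ≤ s}` (`IsThin.sum_abs_sub_le`). Bourgain's embedding into `ℓ₁` bounds an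
arbitrary `d` by a constant times a sum, over `O(log n)` scales, of averages of line metrics
`|distTo d A x - distTo d A y| ≤ d x y` (`le_sum_abs_distTo_sub`). Only the number of scales is
lost, and the matching does not depend on `d`. -/

/-! ### Cut pseudometrics -/

/-- The pseudometric of the cut `(S, Sᶜ)`: the distance is `1` across the cut and `0` elsewhere. -/
def cutPseudoMetric {X : Type*} [DecidableEq X] (S : Finset X) : PseudoMetric X ℝ where
  toFun x y := if Xor (x ∈ S) (y ∈ S) then 1 else 0
  refl' x := by simp
  symm' x y := by simp only [xor_comm]
  triangle' x y z := by
    by_cases hx : x ∈ S <;> by_cases hy : y ∈ S <;> by_cases hz : z ∈ S <;> simp [hx, hy, hz]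

lemma cutPseudoMetric_apply {X : Type*} [DecidableEq X] (S : Finset X) (x y : X) :
    cutPseudoMetric S x y = if Xor (x ∈ S) (y ∈ S) then 1 else 0 := rfl

lemma cost_cutPseudoMetric {n : ℕ} (S : Finset (Vertex n)) (M : PerfectMatching n) :
    cost (cutPseudoMetric S) M = cutSize M S := by
  simp [cost, cutSize, cutPseudoMetric_apply, Finset.sum_boole]

lemma fractionalCost_cutPseudoMetric {n : ℕ} (S : Finset (Vertex n))
    (p : Matrix (Fin n) (Fin n) ℝ) :
    fractionalCost (cutPseudoMetric S) p = cutWeight p S := by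
  simp [fractionalCost, cutWeight, cutPseudoMetric_apply, Finset.sum_filter]

lemma IsRoundingFactor.isThinnessFactor {n : ℕ} {a : ℝ} (h : IsRoundingFactor n a) :
    IsThinnessFactor n a := by
  intro p hp
  obtain ⟨M, hM⟩ := h p hp
  refine ⟨M, fun S => ?_⟩
  rw [← cost_cutPseudoMetric, ← fractionalCost_cutPseudoMetric]
  exact hM _

/-! ### Existence of the optimal factors -/

/-- Every edge crosses the cut `S = A`, so both sides count `n`. This bounds the set of factors
below and makes them nonnegative. -/
lemma one_le_of_isThinnessFactor {n : ℕ} (hn : 1 ≤ n) {b : ℝ} (h : IsThinnessFactor n b) :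
    1 ≤ b := by
  obtain ⟨M, hM⟩ := h 1 (one_mem _)
  have h1 := hM (univ.filter fun v => v.isLeft)
  have h2 : (0 : ℝ) < n := by exact_mod_cast hn
  have hX : Xor True False := Or.inl ⟨trivial, id⟩
  simp [cutSize, cutWeight, Crosses, Matrix.one_apply, hX] at h1
  nlinarith

/-- By Birkhoff's theorem, `p` is a convex combination of `n!` permutations. One of them has weight
at least `1 / n!`, and `p` dominates this weight on its edges. -/
lemma exists_isRoundingFactor (n : ℕ) : ∃ a, IsRoundingFactor n a := by
  refine ⟨Fintype.card (Equiv.Perm (Fin n)), fun p hp => ?_⟩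
  obtain ⟨w, hw0, hw1, rfl⟩ := exists_eq_sum_perm_of_mem_doublyStochastic hp
  have hN : (0 : ℝ) < Fintype.card (Equiv.Perm (Fin n)) := by exact_mod_cast Fintype.card_pos
  obtain ⟨σ, -, hσ⟩ : ∃ σ ∈ (univ : Finset (Equiv.Perm (Fin n))),
      (1 : ℝ) / Fintype.card (Equiv.Perm (Fin n)) ≤ w σ := by
    apply Finset.exists_le_of_sum_le univ_nonempty
    rw [hw1, Finset.sum_const, Finset.card_univ, nsmul_eq_mul]
    field_simp
    rfl
  refine ⟨σ, fun d => ?_⟩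
  have hd := d.nonneg
  set p := ∑ τ, w τ • τ.permMatrix ℝ
  have hp0 : ∀ i j, 0 ≤ p i j := fun i j => nonneg_of_mem_doublyStochastic hp
  have hpσ : ∀ i, w σ ≤ p i (σ i) := by
    intro i
    have : p i (σ i) = ∑ τ, w τ * τ.permMatrix ℝ i (σ i) := by
      simp [p, Matrix.sum_apply]
    rw [this]
    refine le_trans (by simp [Equiv.Perm.permMatrix, PEquiv.toMatrix_apply])
      (Finset.single_le_sum (f := fun τ => w τ * τ.permMatrix ℝ i (σ i)) (fun τ _ => mul_nonneg (hw0 τ) ?_) (mem_univ σ))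
    simp only [Equiv.Perm.permMatrix, PEquiv.toMatrix_apply]
    split_ifs <;> simp
  have key : 1 / (Fintype.card (Equiv.Perm (Fin n)) : ℝ) * cost d σ ≤ fractionalCost d p := by
    rw [cost, fractionalCost, Finset.mul_sum]
    refine Finset.sum_le_sum fun i _ => ?_
    refine le_trans (mul_le_mul_of_nonneg_right (hσ.trans (hpσ i)) (hd _ _)) ?_
    exact Finset.single_le_sum (f := fun j => p i j * d (Sum.inl i) (Sum.inr j))
      (fun j _ => mul_nonneg (hp0 i j) (hd _ _)) (mem_univ (σ i))
  rw [one_div, inv_mul_le_iff₀ hN] at key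
  exact key

/-- For fixed `p` there are finitely many matchings, so the union over `M` of closed sets stays
closed. Closedness is what makes the infimum attained. -/
lemma isClosed_setOf_isRoundingFactor (n : ℕ) : IsClosed {a | IsRoundingFactor n a} := by
  simp only [IsRoundingFactor, Set.ofPred_forall, Set.ofPred_exists]
  exact isClosed_iInter fun p => isClosed_iInter fun _ => isClosed_iUnion_of_finite fun M =>
    isClosed_iInter fun d => isClosed_le (by fun_prop) (by fun_prop)

lemma isClosed_setOf_isThinnessFactor (n : ℕ) : IsClosed {b | IsThinnessFactor n b} := by
  simp only [IsThinnessFactor, IsThin, Set.ofPred_forall, Set.ofPred_exists]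
  exact isClosed_iInter fun p => isClosed_iInter fun _ => isClosed_iUnion_of_finite fun M =>
    isClosed_iInter fun S => isClosed_le (by fun_prop) (by fun_prop)

lemma bddBelow_setOf_isThinnessFactor {n : ℕ} (hn : 1 ≤ n) :
    BddBelow {b | IsThinnessFactor n b} :=
  ⟨1, fun _ hb => one_le_of_isThinnessFactor hn hb⟩

lemma bddBelow_setOf_isRoundingFactor {n : ℕ} (hn : 1 ≤ n) :
    BddBelow {a | IsRoundingFactor n a} :=
  (bddBelow_setOf_isThinnessFactor hn).mono fun _ => IsRoundingFactor.isThinnessFactor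

lemma isLeast_optRounding {n : ℕ} (hn : 1 ≤ n) :
    IsLeast {a | IsRoundingFactor n a} (optRounding n) :=
  (isClosed_setOf_isRoundingFactor n).isLeast_csInf (exists_isRoundingFactor n)
    (bddBelow_setOf_isRoundingFactor hn)

lemma isLeast_optThinness {n : ℕ} (hn : 1 ≤ n) :
    IsLeast {b | IsThinnessFactor n b} (optThinness n) :=
  (isClosed_setOf_isThinnessFactor n).isLeast_csInf
    ((exists_isRoundingFactor n).imp fun _ => IsRoundingFactor.isThinnessFactor)
    (bddBelow_setOf_isThinnessFactor hn)

/-! ### Line metrics as integrals of cut pseudometrics -/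

/-- The indicator of the thresholds `s` that separate `u` from `v`. -/
def separates (u v : ℝ) : ℝ → ℝ := (Set.Ico (min u v) (max u v)).indicator 1

/-- The half-open interval makes this exact for the sublevel cuts `{f ≤ s}`, even at the endpoints.
-/
lemma separates_apply (u v s : ℝ) :
    separates u v s = if Xor (u ≤ s) (v ≤ s) then 1 else 0 := by
  rw [separates, Set.indicator_apply]
  congr 1
  simp only [Set.mem_Ico, min_le_iff, Xor, ← not_le, max_le_iff, eq_iff_iff]
  tauto

lemma separates_nonneg (u v s : ℝ) : 0 ≤ separates u v s := by
  rw [separates_apply]; split_ifs <;> simp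

lemma separates_comm (u v s : ℝ) : separates u v s = separates v u s := by
  simp only [separates_apply, xor_comm]

lemma integrable_separates (u v : ℝ) : Integrable (separates u v) :=
  (integrable_indicator_iff measurableSet_Ico).2 (integrableOn_const (by simp))

lemma integral_separates (u v : ℝ) : ∫ s, separates u v s = |u - v| := by
  rw [separates, integral_indicator_one measurableSet_Ico,
    Real.volume_real_Ico_of_le (min_le_max), max_sub_min_eq_abs']

/-- Thinness bounds the cost of the matching in every line metric. -/
lemma IsThin.sum_abs_sub_le {n : ℕ} {b : ℝ} {p : Matrix (Fin n) (Fin n) ℝ}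
    {M : PerfectMatching n} (h : IsThin b p M) (f : Vertex n → ℝ) :
    ∑ i, |f (Sum.inl i) - f (Sum.inr (M i))| ≤
      b * ∑ i, ∑ j, p i j * |f (Sum.inl i) - f (Sum.inr j)| := by
  have hint : ∀ i j, Integrable fun s => p i j * separates (f (Sum.inl i)) (f (Sum.inr j)) s :=
    fun i j => (integrable_separates _ _).const_mul _
  have hint' : ∀ i, Integrable fun s =>
      ∑ j, p i j * separates (f (Sum.inl i)) (f (Sum.inr j)) s :=
    fun i => integrable_finsetSum _ fun j _ => hint i j
  calc ∑ i, |f (Sum.inl i) - f (Sum.inr (M i))|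
      = ∫ s, ∑ i, separates (f (Sum.inl i)) (f (Sum.inr (M i))) s := by
        rw [integral_finsetSum _ fun i _ => integrable_separates _ _]
        simp only [integral_separates]
    _ ≤ ∫ s, b * ∑ i, ∑ j, p i j * separates (f (Sum.inl i)) (f (Sum.inr j)) s := by
        refine integral_mono (integrable_finsetSum _ fun i _ => integrable_separates _ _)
          ((integrable_finsetSum _ fun i _ => hint' i).const_mul b) fun s => ?_
        have := h (univ.filter fun x => f x ≤ s)
        rw [← cost_cutPseudoMetric, ← fractionalCost_cutPseudoMetric] at this
        simpa [cost, fractionalCost, cutPseudoMetric_apply, separates_apply] using this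
    _ = b * ∑ i, ∑ j, p i j * |f (Sum.inl i) - f (Sum.inr j)| := by
        rw [integral_const_mul, integral_finsetSum _ fun i _ => hint' i]
        congr 1
        refine Finset.sum_congr rfl fun i _ => ?_
        rw [integral_finsetSum _ fun j _ => hint i j]
        simp only [integral_const_mul, integral_separates]

/-! ### Random subsets -/

section RandomSubset

variable {X : Type*} [Fintype X]

/-- The probability of `A` when each point is chosen independently with probability `q`. -/
def bernoulliWeight (q : ℝ) (A : Finset X) : ℝ := q ^ #A * (1 - q) ^ (Fintype.card X - #A)

lemma bernoulliWeight_nonneg {q : ℝ} (h0 : 0 ≤ q) (h1 : q ≤ 1) (A : Finset X) :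
    0 ≤ bernoulliWeight q A :=
  mul_nonneg (pow_nonneg h0 _) (pow_nonneg (sub_nonneg.2 h1) _)

lemma sum_bernoulliWeight (q : ℝ) : ∑ A : Finset X, bernoulliWeight q A = 1 := by
  simp [bernoulliWeight, Fintype.sum_pow_mul_eq_add_pow]

variable [DecidableEq X]

/-- The probability that a random subset misses `C`. -/
lemma sum_bernoulliWeight_disjoint (q : ℝ) (C : Finset X) :
    ∑ A with Disjoint A C, bernoulliWeight q A = (1 - q) ^ #C := by
  have hS : (univ.filter fun A => Disjoint A C) = Cᶜ.powerset := by
    ext A; simp [Finset.subset_compl_iff_disjoint_right]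
  have hw : ∀ A ∈ Cᶜ.powerset,
      bernoulliWeight q A = (1 - q) ^ #C * (q ^ #A * (1 - q) ^ (#Cᶜ - #A)) := by
    intro A hA
    have h1 := Finset.card_le_card (Finset.mem_powerset.1 hA)
    have h2 := Finset.card_add_card_compl C
    rw [bernoulliWeight, show Fintype.card X - #A = #C + (#Cᶜ - #A) by omega, pow_add]
    ring
  rw [hS, Finset.sum_congr rfl hw, ← Finset.mul_sum, Finset.sum_pow_mul_eq_add_pow]
  simp

/-- The probability that a random subset misses `C` and meets `B`. -/
lemma sum_bernoulliWeight_disjoint_not_disjoint (q : ℝ) {B C : Finset X} (h : Disjoint B C) :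
    ∑ A with Disjoint A C ∧ ¬Disjoint A B, bernoulliWeight q A =
      (1 - q) ^ #C * (1 - (1 - q) ^ #B) := by
  have h1 := Finset.sum_filter_add_sum_filter_not (univ.filter fun A : Finset X => Disjoint A C)
    (fun A => Disjoint A B) (bernoulliWeight q)
  simp only [Finset.filter_filter, sum_bernoulliWeight_disjoint] at h1
  have h2 := sum_bernoulliWeight_disjoint q (B ∪ C)
  simp only [Finset.disjoint_union_right, Finset.card_union_of_disjoint h] at h2
  simp only [and_comm (a := Disjoint _ C)] at h1 ⊢
  rw [h2] at h1
  rw [eq_sub_of_add_eq' h1]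
  ring

/-- At density `2⁻⁽ᵗ⁺¹⁾`, a random subset meets a set of about `2ᵗ` points and misses a disjoint
set that is not larger, with probability bounded below. -/
lemma one_div_twelve_le_sum_bernoulliWeight {t : ℕ} {B C : Finset X} (h : Disjoint B C)
    (hB : 2 ^ t ≤ #B) (hC : #C ≤ 2 ^ (t + 1)) :
    1 / 12 ≤ ∑ A with Disjoint A C ∧ ¬Disjoint A B,
      bernoulliWeight (1 / 2 ^ (t + 1) : ℝ) A := by
  rw [sum_bernoulliWeight_disjoint_not_disjoint _ h]
  set q : ℝ := 1 / 2 ^ (t + 1) with hq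
  have hk : (0 : ℝ) < 2 ^ t := by positivity
  have hqk : (2 : ℝ) ^ t * q = 1 / 2 := by rw [hq, pow_succ]; field_simp
  have hq0 : 0 < q := by positivity
  have hq1 : q ≤ 1 / 2 := by
    have : (1 : ℝ) ≤ 2 ^ t := one_le_pow₀ (by norm_num)
    nlinarith
  -- Bernoulli's inequality gives `1 - 2 ^ t * q = 1 / 2`; squaring reaches the exponent `2 ^ (t +
  -- 1)`.
  have hmiss : 1 / 4 ≤ (1 - q) ^ #C := by
    have h1 : 1 / 2 ≤ (1 - q) ^ 2 ^ t := by
      have := one_add_mul_le_pow (a := -q) (by linarith) (2 ^ t)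
      push_cast at this
      rw [← sub_eq_add_neg] at this
      linarith
    calc (1 / 4 : ℝ) = (1 / 2) ^ 2 := by norm_num
      _ ≤ ((1 - q) ^ 2 ^ t) ^ 2 := by gcongr
      _ = (1 - q) ^ 2 ^ (t + 1) := by rw [← pow_mul, pow_succ]
      _ ≤ (1 - q) ^ #C := pow_le_pow_of_le_one (by linarith) (by linarith) hC
  -- An upper bound comes from Bernoulli for `1 + q` and `(1 - q) * (1 + q) ≤ 1`. The final constant
  -- is `1/4 * (1 - 2/3) = 1/12`.
  have hhit : (1 - q) ^ #B ≤ 2 / 3 := by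
    have h1 : 3 / 2 ≤ (1 + q) ^ 2 ^ t := by
      have := one_add_mul_le_pow (a := q) (by linarith) (2 ^ t)
      push_cast at this
      linarith
    have h2 : (1 - q) ^ 2 ^ t * (1 + q) ^ 2 ^ t ≤ 1 := by
      rw [← mul_pow]
      exact pow_le_one₀ (by nlinarith) (by nlinarith)
    have h3 : 0 ≤ (1 - q) ^ 2 ^ t := pow_nonneg (by linarith) _
    refine (pow_le_pow_of_le_one (by linarith) (by linarith) hB).trans ?_
    nlinarith
  nlinarith

end RandomSubset

/-! ### Bourgain's embedding -/

section Embedding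

variable {X : Type*} (d : PseudoMetric X ℝ)

/-- The distance of `x` from the set `A`, with value `0` for empty `A`. -/
def distTo (A : Finset X) (x : X) : ℝ := if h : A.Nonempty then A.inf' h (d x) else 0

lemma distTo_sub_le (A : Finset X) (x y : X) : distTo d A x - distTo d A y ≤ d x y := by
  unfold distTo
  split_ifs with h
  · obtain ⟨a, ha, hya⟩ := A.exists_mem_eq_inf' h (d y)
    have h1 := A.inf'_le (d x) ha
    have h2 := d.triangle x y a
    linarith
  · simpa using d.nonneg x y

lemma abs_distTo_sub_le (A : Finset X) (x y : X) : |distTo d A x - distTo d A y| ≤ d x y :=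
  abs_sub_le_iff.2 ⟨distTo_sub_le d A x y, d.symm x y ▸ distTo_sub_le d A y x⟩

variable [Fintype X]

/-- The closed ball. -/
def ballFinset (x : X) (s : ℝ) : Finset X := univ.filter fun z => d x z ≤ s

lemma separates_distTo {A : Finset X} {x y : X} {s : ℝ}
    (hx : ¬Disjoint A (ballFinset d x s)) (hy : Disjoint A (ballFinset d y s)) :
    separates (distTo d A x) (distTo d A y) s = 1 := by
  obtain ⟨a, haA, ha⟩ := Finset.not_disjoint_iff.1 hx
  have hA : A.Nonempty := ⟨a, haA⟩
  have h1 : distTo d A x ≤ s := by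
    rw [distTo, dif_pos hA]
    exact (A.inf'_le (d x) haA).trans (Finset.mem_filter.1 ha).2
  have h2 : s < distTo d A y := by
    rw [distTo, dif_pos hA, Finset.lt_inf'_iff]
    intro z hz
    by_contra! hle
    exact Finset.disjoint_left.1 hy hz (Finset.mem_filter.2 ⟨mem_univ _, hle⟩)
  have hX : Xor (distTo d A x ≤ s) (distTo d A y ≤ s) := Or.inl ⟨h1, not_le.2 h2⟩
  rw [separates_apply, if_pos hX]

variable [DecidableEq X]

/-- The scale that matches the size of the larger ball contributes a constant. -/
lemma one_div_twelve_le_sum_separates_of_card_le {x y : X} {s : ℝ} (hs : 0 ≤ s)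
    (hxy : s < d x y / 2) (hcard : #(ballFinset d y s) ≤ #(ballFinset d x s)) :
    1 / 12 ≤ ∑ t ∈ range (Nat.log 2 (Fintype.card X) + 1), ∑ A : Finset X,
      bernoulliWeight (1 / 2 ^ (t + 1) : ℝ) A * separates (distTo d A x) (distTo d A y) s := by
  set B := ballFinset d x s with hB
  set C := ballFinset d y s with hC
  have hBC : Disjoint B C := by
    refine Finset.disjoint_left.2 fun z hzB hzC => ?_
    have h1 := (Finset.mem_filter.1 hzB).2
    have h2 := (Finset.mem_filter.1 hzC).2
    have h3 := d.triangle x z y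
    rw [d.symm z y] at h3
    linarith
  have hB0 : #B ≠ 0 := Finset.card_ne_zero_of_mem
    (Finset.mem_filter.2 ⟨mem_univ x, by rw [d.refl]; exact hs⟩)
  have hw : ∀ (t : ℕ) (A : Finset X), 0 ≤ bernoulliWeight (1 / 2 ^ (t + 1) : ℝ) A := fun t A =>
    bernoulliWeight_nonneg (by positivity)
      (div_le_one_of_le₀ (one_le_pow₀ (by norm_num)) (by positivity)) A
  have hnn : ∀ (t : ℕ) (A : Finset X), 0 ≤
      bernoulliWeight (1 / 2 ^ (t + 1) : ℝ) A * separates (distTo d A x) (distTo d A y) s :=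
    fun t A => mul_nonneg (hw t A) (separates_nonneg _ _ _)
  -- The useful scale is `t = Nat.log 2 #B`, for which `2 ^ t ≤ #B < 2 ^ (t + 1)`; the other scales
  -- are dropped as nonnegative.
  have ht : Nat.log 2 #B ∈ range (Nat.log 2 (Fintype.card X) + 1) :=
    Finset.mem_range.2 (Nat.lt_succ_of_le (Nat.log_mono_right (Finset.card_le_univ B)))
  refine le_trans ?_ (Finset.single_le_sum (fun t _ => Finset.sum_nonneg fun A _ => hnn t A) ht)
  refine (one_div_twelve_le_sum_bernoulliWeight hBC (Nat.pow_log_le_self 2 hB0)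
    (hcard.trans (Nat.lt_pow_succ_log_self one_lt_two _).le)).trans ?_
  rw [Finset.sum_filter]
  refine Finset.sum_le_sum fun A _ => ?_
  split_ifs with hA
  · rw [separates_distTo d hA.2 hA.1, mul_one]
  · exact hnn _ _

lemma one_div_twelve_le_sum_separates {x y : X} {s : ℝ} (hs : 0 ≤ s) (hxy : s < d x y / 2) :
    1 / 12 ≤ ∑ t ∈ range (Nat.log 2 (Fintype.card X) + 1), ∑ A : Finset X,
      bernoulliWeight (1 / 2 ^ (t + 1) : ℝ) A * separates (distTo d A x) (distTo d A y) s := by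
  rcases le_total #(ballFinset d y s) #(ballFinset d x s) with h | h
  · exact one_div_twelve_le_sum_separates_of_card_le d hs hxy h
  · simp only [separates_comm (distTo d _ x)]
    exact one_div_twelve_le_sum_separates_of_card_le d hs (d.symm x y ▸ hxy) h

/-- The expansion half of Bourgain's theorem. -/
lemma le_sum_abs_distTo_sub (x y : X) :
    d x y ≤ 24 * ∑ t ∈ range (Nat.log 2 (Fintype.card X) + 1), ∑ A : Finset X,
      bernoulliWeight (1 / 2 ^ (t + 1) : ℝ) A * |distTo d A x - distTo d A y| := by
  have hint : ∀ (t : ℕ) (A : Finset X), Integrable fun s =>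
      bernoulliWeight (1 / 2 ^ (t + 1) : ℝ) A * separates (distTo d A x) (distTo d A y) s :=
    fun t A => (integrable_separates _ _).const_mul _
  have hint' : ∀ t : ℕ, Integrable fun s => ∑ A : Finset X,
      bernoulliWeight (1 / 2 ^ (t + 1) : ℝ) A * separates (distTo d A x) (distTo d A y) s :=
    fun t => integrable_finsetSum _ fun A _ => hint t A
  have hd := d.nonneg x y
  -- The pointwise bound `1/12` holds for all radii below `d x y / 2`, where the two balls are
  -- disjoint; integrating gives `d x y / 24`.
  have key : ∫ s, (Set.Ico 0 (d x y / 2)).indicator (fun _ => (1 / 12 : ℝ)) s ≤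
      ∫ s, ∑ t ∈ range (Nat.log 2 (Fintype.card X) + 1), ∑ A : Finset X,
        bernoulliWeight (1 / 2 ^ (t + 1) : ℝ) A * separates (distTo d A x) (distTo d A y) s := by
    refine integral_mono ((integrable_indicator_iff measurableSet_Ico).2
      (integrableOn_const (by simp))) (integrable_finsetSum _ fun t _ => hint' t) fun s => ?_
    refine Set.indicator_apply_le' (fun hs => one_div_twelve_le_sum_separates d hs.1 hs.2)
      fun _ => Finset.sum_nonneg fun t _ => Finset.sum_nonneg fun A _ =>
        mul_nonneg (bernoulliWeight_nonneg (by positivity)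
          (div_le_one_of_le₀ (one_le_pow₀ (by norm_num)) (by positivity)) A)
          (separates_nonneg _ _ _)
  rw [integral_indicator_const _ measurableSet_Ico, Real.volume_real_Ico_of_le (by linarith),
    integral_finsetSum _ fun t _ => hint' t, smul_eq_mul] at key
  simp only [integral_finsetSum _ fun A _ => hint _ A, integral_const_mul,
    integral_separates] at key
  linarith

end Embedding

/-! ### Comparison of the two factors -/

lemma IsThin.cost_le {n : ℕ} {b : ℝ} (hb : 0 ≤ b) {p : Matrix (Fin n) (Fin n) ℝ}
    (hp : IsFractionalMatching p) {M : PerfectMatching n} (h : IsThin b p M)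
    (d : PseudoMetric (Vertex n) ℝ) :
    cost d M ≤ 24 * (Nat.log 2 (2 * n) + 1) * b * fractionalCost d p := by
  have hp0 : ∀ i j, 0 ≤ p i j := fun i j => nonneg_of_mem_doublyStochastic hp
  have hcard : Fintype.card (Vertex n) = 2 * n := by simp [two_mul]
  set w : ℕ → Finset (Vertex n) → ℝ := fun t => bernoulliWeight (1 / 2 ^ (t + 1)) with hw_def
  have hw : ∀ t A, 0 ≤ w t A := fun t A => bernoulliWeight_nonneg (by positivity)
    (div_le_one_of_le₀ (one_le_pow₀ (by norm_num)) (by positivity)) A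
  calc cost d M
      ≤ ∑ i, 24 * ∑ t ∈ range (Nat.log 2 (2 * n) + 1), ∑ A : Finset (Vertex n),
          w t A * |distTo d A (Sum.inl i) - distTo d A (Sum.inr (M i))| :=
        Finset.sum_le_sum fun i _ => hcard ▸ le_sum_abs_distTo_sub d _ _
    _ = 24 * ∑ t ∈ range (Nat.log 2 (2 * n) + 1), ∑ A : Finset (Vertex n),
          w t A * ∑ i, |distTo d A (Sum.inl i) - distTo d A (Sum.inr (M i))| := by
        rw [← Finset.mul_sum, Finset.sum_comm]
        congr 1
        refine Finset.sum_congr rfl fun t _ => ?_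
        rw [Finset.sum_comm]
        simp only [Finset.mul_sum]
    _ ≤ 24 * ∑ t ∈ range (Nat.log 2 (2 * n) + 1), ∑ A : Finset (Vertex n),
          w t A * (b * fractionalCost d p) := by
        -- Thinness handles each line metric, and the 1-Lipschitz bound returns to `d`. The weights
        -- at each scale then sum to `1`.
        gcongr with t _ A _
        · exact hw t A
        refine (h.sum_abs_sub_le (distTo d A)).trans ?_
        rw [fractionalCost]
        gcongr with i _ j _
        · exact hp0 i j
        · exact abs_distTo_sub_le d A _ _
    _ = 24 * (Nat.log 2 (2 * n) + 1) * b * fractionalCost d p := by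
        simp only [← Finset.sum_mul, hw_def, sum_bernoulliWeight, one_mul, Finset.sum_const,
          Finset.card_range, nsmul_eq_mul]
        push_cast
        ring

lemma IsThinnessFactor.isRoundingFactor {n : ℕ} {b : ℝ} (hb : 0 ≤ b)
    (h : IsThinnessFactor n b) : IsRoundingFactor n (24 * (Nat.log 2 (2 * n) + 1) * b) := by
  intro p hp
  obtain ⟨M, hM⟩ := h p hp
  exact ⟨M, hM.cost_le hb hp⟩

lemma natLog_two_mul_add_one_le {n : ℕ} (hn : 2 ≤ n) :
    (Nat.log 2 (2 * n) + 1 : ℝ) ≤ 3 / Real.log 2 * Real.log n := by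
  have h2 : 0 < Real.log 2 := Real.log_pos one_lt_two
  have hlog : Real.log 2 ≤ Real.log n := Real.log_le_log (by norm_num) (by exact_mod_cast hn)
  have hN : (Nat.log 2 (2 * n) : ℝ) = Nat.log 2 n + 1 := by
    rw [mul_comm, Nat.log_mul_base one_lt_two (by omega)]
    push_cast
    rfl
  have h3 : (Nat.log 2 n : ℝ) ≤ Real.log n / Real.log 2 := by
    simpa [Real.logb] using Real.natLog_le_logb n 2
  -- Here `n ≥ 2` absorbs the additive `2` in `Nat.log 2 n + 2`, whence the factor `3`.
  have h4 : 1 ≤ Real.log n / Real.log 2 := (one_le_div h2).2 hlog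
  rw [hN, div_mul_eq_mul_div, mul_div_assoc]
  linarith

end ThinMatching

end

/-- For `n ≥ 1` both infima are attained, so that they are the smallest valid factors. -/
theorem mainTheorem5 :
    (∀ n : ℕ, 1 ≤ n →
      IsLeast {a : ℝ | ThinMatching.IsRoundingFactor n a} (ThinMatching.optRounding n) ∧
      IsLeast {b : ℝ | ThinMatching.IsThinnessFactor n b} (ThinMatching.optThinness n) ∧
      ThinMatching.optThinness n ≤ ThinMatching.optRounding n) ∧
    ∃ C : ℝ, 0 < C ∧ ∀ n : ℕ, 2 ≤ n →
      ThinMatching.optRounding n ≤ C * Real.log n * ThinMatching.optThinness n := by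
  refine ⟨fun n hn => ?_, 24 * (3 / Real.log 2), by positivity, fun n hn => ?_⟩
  · have hα := ThinMatching.isLeast_optRounding hn
    have hβ := ThinMatching.isLeast_optThinness hn
    exact ⟨hα, hβ, hβ.2 (ThinMatching.IsRoundingFactor.isThinnessFactor hα.1)⟩
  · have hn1 : 1 ≤ n := by omega
    have hβ := (ThinMatching.isLeast_optThinness hn1).1
    have hβ0 : 0 ≤ ThinMatching.optThinness n :=
      zero_le_one.trans (ThinMatching.one_le_of_isThinnessFactor hn1 hβ)
    refine ((ThinMatching.isLeast_optRounding hn1).2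
      (ThinMatching.IsThinnessFactor.isRoundingFactor hβ0 hβ)).trans ?_
    rw [mul_assoc 24 (3 / Real.log 2)]
    gcongr
    exact ThinMatching.natLog_two_mul_add_one_le hn
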